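/- Let $K$ be a totally real number field of degree $d$ with ring of integers $O_K$, let $b\in O_K\setminus\{0\}$, and let $F(X,Y)\in O_K[X,Y]$ be a form (homogeneous polynomial) of degree $n\ge 2$. Write $a_0$ and $a_n$ for the coefficients of $X^n$ and $Y^n$ in $F$. Let $H$ denote the absolute multiplicative height: for a projective point ${\bf x}=(x_0:\dots:x_m)$ over $K$, $H({\bf x})=\prod_{v}\max_i|x_i|_v^{d_v/d}$, where $v$ runs over all places of $K$, $d_v$ is the local degree and $|\cdot|_v$ extends the usual absolute value ($|p|_p=p^{-1}$) of $\mathbb{Q}$; for $x\in K$, $H(x)=H((1:x))$; $H(F)$ is the height of the point whose coordinates are the coefficients of $F$, and $\Gamma$ is the point whose coordinates are $1$ and the coefficients of $F$. Let $N_K(a)$ denote the absolute value of the norm of $a\in O_K$ relative to $K/\mathbb{Q}$. Suppose that $F(X,1)$ has a root $\alpha$ such that $K(\alpha)$ is a CM-field (a totally imaginary quadratic extension of a totally real number field). Then every solution $(x,y)\in O_K^2$ of $F(x,y)=b$ satisfies $H(x)<\Omega_1$ and $H(y)<\Omega_2$ with the following values. (i) If $a_0=\pm1$ and $a_n=\pm1$,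 then $$\Omega_1=\Omega_2=32\,H(b)^{1/n}H(F)^{1+1/n}N_K(b)^{2/d}.$$ (ii) If $a_0=\pm1$ and $a_n\neq\pm1$, then $$\Omega_1=2^9\,H(b)^{1/n}H(F)^{2+1/n}N_K(b)^{4/d},\qquad \Omega_2=32\,H(b)^{1/n}H(F)^{1+1/n}N_K(b)^{2/d}.$$ (iii) If $a_0\neq\pm1$, $a_n\neq\pm1$ and $a_0\neq 0$, then $$\Omega_1=2^9\,H(b)^{1/n}H(\Gamma)^{2n+1}N_K(b)^{4/d}H(a_0)^{n-1}N_K(a_0)^{2(n-1)/d},$$ $$\Omega_2=32\,H(b)^{1/n}H(\Gamma)^{n+1}N_K(b)^{2/d}H(a_0)^{n-1}N_K(a_0)^{2(n-1)/d}.$$ Furthermore (without any condition on $a_0$ and $a_n$), the number of solutions $(x,y)\in O_K^2$ of $F(x,y)=b$ is finite and at most $72\cdot4^{dn}N_K(b)^{2n}$; and if $b$ is a unit of $O_K$, this number is at most $2wn$, where $w$ is the number of roots of unity in $K(\alpha)$. -/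

import Mathlib

open NumberField IntermediateField

noncomputable section

/-- The absolute height `H(x) = H_K((1 : x))^{1/d}` of an algebraic integer `x` of the number
field `K` of degree `d`. (`Height.mulHeight₁` is the field height `H_K`: the product over all
places, with local degrees as multiplicities.) -/
def absHeight {K : Type*} [Field K] [NumberField K] (x : 𝓞 K) : ℝ :=
  Height.mulHeight₁ (x : K) ^ (1 / (Module.finrank ℚ K : ℝ))

/-- The absolute height `H(F)` of a polynomial `F`: the absolute height of the projective point
whose coordinates are the coefficients of `F` (zero coordinates do not matter). -/
def polyHeight {K : Type*} [Field K] [NumberField K] {σ : Type*}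
    (F : MvPolynomial σ (𝓞 K)) : ℝ :=
  Height.mulHeight (fun m : F.support ↦ ((F.coeff m.1 : 𝓞 K) : K)) ^
    (1 / (Module.finrank ℚ K : ℝ))

/-- The absolute height `H(Γ)` of the projective point `Γ` whose coordinates are `1` and the
coefficients of `F`. -/
def polyHeightOne {K : Type*} [Field K] [NumberField K] {σ : Type*}
    (F : MvPolynomial σ (𝓞 K)) : ℝ :=
  Height.mulHeight (fun i : Option F.support ↦
      (i.elim 1 (fun m ↦ ((F.coeff m.1 : 𝓞 K) : K)) : K)) ^
    (1 / (Module.finrank ℚ K : ℝ))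

/-- The absolute value of the norm of `b` relative to `K / ℚ`, as a natural number. -/
def absNorm {K : Type*} [Field K] [NumberField K] (b : 𝓞 K) : ℕ :=
  (Algebra.norm ℤ b).natAbs

/-- The element is `1` or `-1`. -/
def IsPlusMinusOne {R : Type*} [Ring R] (a : R) : Prop := a = 1 ∨ a = -1

/-- The solutions `(x, y) ∈ O_K²` of `F(x, y) = b`. -/
def thueSolutions {K : Type*} [Field K] [NumberField K]
    (F : MvPolynomial (Fin 2) (𝓞 K)) (b : 𝓞 K) : Set (𝓞 K × 𝓞 K) :=
  {p | MvPolynomial.eval ![p.1, p.2] F = b}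

/-- The number of roots of unity of a field. -/
def numRootsOfUnity (L : Type*) [Field L] : ℕ :=
  Nat.card {ζ : L // ∃ k : ℕ, 0 < k ∧ ζ ^ k = 1}

end

/-! Put `M = K(α)`, with complex conjugation `α ↦ α'`, which fixes the totally real field `K`. At
every infinite place `w` of `M` the conjugate factors `x - α y` and `x - α' y` have the same
absolute value, so `(α' - α) y = (x - α y) - (x - α' y)`, and a similar identity for `x`, bounds
both unknowns by `|x - α y|_w` (`infinitePlace_sub_complexConj_mul_max_le`).

Heights: let `a` be the coefficient of `X ^ n`. When `a ≠ 0`, `a (x - α y)` is an integer dividing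
`a ^ (n - 1) b`, and `a (α' - α)` is a nonzero integer, of norm at least `1`. Multiplying over all
`w` bounds `∏ max(|x|, |y|)` (`prod_max_le_of_binaryForm_eq`), whence the heights, with constant
`8`.

Counting: for solutions `p`, `p₀` with linear factors `ℓ(p)`, `ℓ(p₀)`, the quotient `b ℓ(p₀) / ℓ(p)`
is an integer dividing `b ^ 2`. If two of these agree modulo `b ^ 2`, they are associated and the
linear factors differ by a unit `u`. The root of unity `u / u'` determines `u` up to real units, and
a real ratio of linear factors forces `p = ± q`. So there are at most `2 w N(b) ^ (2 [M : K])`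
solutions (`finite_and_ncard_binaryForm_le`), with `[M : K] ≤ n`. -/

/-! ### Binary forms and their linear factors -/

section BinaryForms

/-- The value at `(x, y)` of the binary form of degree `n` in which `X ^ i * Y ^ (n - i)` has the
coefficient `c i`. -/
def binaryForm {R : Type*} [CommSemiring R] (c : ℕ → R) (n : ℕ) (x y : R) : R :=
  ∑ i ∈ Finset.range (n + 1), c i * x ^ i * y ^ (n - i)

lemma map_binaryForm {R S : Type*} [CommSemiring R] [CommSemiring S] (f : R →+* S) (c : ℕ → R)
    (n : ℕ) (x y : R) : f (binaryForm c n x y) = binaryForm (f ∘ c) n (f x) (f y) := by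
  simp [binaryForm]

lemma binaryForm_mul_mul {R : Type*} [CommSemiring R] (c : ℕ → R) (n : ℕ) (r x y : R) :
    binaryForm c n (r * x) (r * y) = r ^ n * binaryForm c n x y := by
  rw [binaryForm, binaryForm, Finset.mul_sum]
  refine Finset.sum_congr rfl fun i hi ↦ ?_
  rw [← Nat.add_sub_of_le (Finset.mem_range_succ_iff.mp hi), Nat.add_sub_cancel_left]
  ring

lemma binaryForm_swap {R : Type*} [CommSemiring R] (c : ℕ → R) (n : ℕ) (x y : R) :
    binaryForm (fun i ↦ c (n - i)) n y x = binaryForm c n x y := by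
  rw [binaryForm, binaryForm, ← Finset.sum_range_reflect]
  refine Finset.sum_congr rfl fun i hi ↦ ?_
  have hi := Finset.mem_range_succ_iff.mp hi
  simp only [Nat.add_sub_cancel, Nat.sub_sub_self hi]
  ring

lemma sub_dvd_binaryForm_sub {R : Type*} [CommRing R] (c : ℕ → R) (n : ℕ) (x x' y : R) :
    x - x' ∣ binaryForm c n x y - binaryForm c n x' y := by
  rw [binaryForm, binaryForm, ← Finset.sum_sub_distrib]
  refine Finset.dvd_sum fun i _ ↦ ?_
  rw [← sub_mul, ← mul_sub]
  exact ((sub_dvd_pow_sub_pow x x' i).mul_left _).mul_right _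

lemma sub_mul_dvd_binaryForm {R : Type*} [CommRing R] {c : ℕ → R} {n : ℕ} {a : R}
    (ha : binaryForm c n a 1 = 0) (x y : R) : x - a * y ∣ binaryForm c n x y := by
  have h := sub_dvd_binaryForm_sub c n x (a * y) y
  have h0 := binaryForm_mul_mul c n y a 1
  rw [mul_one, ha, mul_zero, mul_comm] at h0
  rwa [h0, sub_zero] at h

/-- The coefficients of the monic form `a ^ (n - 1) * F (X / a, Y)`, `a` the coefficient of
`X ^ n` in `F`. -/
def monicCoeff {R : Type*} [CommSemiring R] (c : ℕ → R) (n : ℕ) (i : ℕ) : R :=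
  if i = n then 1 else c i * c n ^ (n - 1 - i)

lemma binaryForm_monicCoeff {R : Type*} [CommSemiring R] (c : ℕ → R) {n : ℕ} (hn : n ≠ 0)
    (x y : R) :
    binaryForm (monicCoeff c n) n (c n * x) y = c n ^ (n - 1) * binaryForm c n x y := by
  rw [binaryForm, binaryForm, Finset.mul_sum]
  refine Finset.sum_congr rfl fun i hi ↦ ?_
  rcases eq_or_ne i n with rfl | h
  · simp only [monicCoeff, if_true]
    obtain ⟨k, rfl⟩ := Nat.exists_eq_succ_of_ne_zero hn
    simp only [Nat.succ_eq_add_one, Nat.add_sub_cancel]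
    ring
  · have : i ≤ n - 1 := by have := Finset.mem_range_succ_iff.mp hi; omega
    obtain ⟨k, hk⟩ := Nat.exists_eq_add_of_le this
    simp only [monicCoeff, if_neg h, hk, Nat.add_sub_cancel_left]
    ring

lemma map_monicCoeff {R S : Type*} [CommSemiring R] [CommSemiring S] (f : R →+* S) (c : ℕ → R)
    (n : ℕ) : f ∘ monicCoeff c n = monicCoeff (f ∘ c) n := by
  funext i
  simp only [monicCoeff, Function.comp]
  split_ifs <;> simp

lemma isIntegral_of_binaryForm_eq_zero {R S : Type*} [CommRing R] [CommRing S] [Algebra R S]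
    (c : ℕ → R) (n : ℕ) (x : S) (h : binaryForm (algebraMap R S ∘ c) n x 1 = 0) :
    IsIntegral R (algebraMap R S (c n) * x) := by
  nontriviality R
  let p : Polynomial R := ∑ i ∈ Finset.range (n + 1), Polynomial.C (c i) * Polynomial.X ^ i
  have hp : Polynomial.aeval x p = 0 := by
    rw [← h]; simp [p, binaryForm]
  have hcoeff : p.coeff n = c n := by simp [p, Polynomial.finsetSum_coeff]
  have hdeg : p.natDegree ≤ n := by
    refine Polynomial.natDegree_sum_le_of_forall_le _ _ fun i hi ↦ ?_
    exact (Polynomial.natDegree_C_mul_X_pow_le _ _).trans (Finset.mem_range_succ_iff.mp hi)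
  rcases eq_or_ne (c n) 0 with h0 | h0
  · simpa [h0] using isIntegral_zero
  · have hlead : p.leadingCoeff = c n := by
      rw [Polynomial.leadingCoeff, le_antisymm hdeg (Polynomial.le_natDegree_of_ne_zero
        (hcoeff ▸ h0)), hcoeff]
    simpa [hlead, Algebra.smul_def] using isIntegral_leadingCoeff_smul p x hp

lemma MvPolynomial.IsHomogeneous.aeval_eq_binaryForm {R S : Type*} [CommSemiring R] [CommSemiring S]
    [Algebra R S] {F : MvPolynomial (Fin 2) R} {n : ℕ} (hF : F.IsHomogeneous n) (x y : S) :
    MvPolynomial.aeval ![x, y] F = binaryForm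
      (fun i ↦ algebraMap R S (F.coeff (Finsupp.single 0 i + Finsupp.single 1 (n - i)))) n x y := by
  classical
  have hdeg : ∀ m ∈ F.support, m 0 + m 1 = n := fun m hm ↦ by
    have := hF (MvPolynomial.mem_support_iff.mp hm)
    simpa [Finsupp.weight_apply, Finsupp.sum_fintype] using this
  have hm : ∀ m ∈ F.support, m = Finsupp.single 0 (m 0) + Finsupp.single 1 (n - m 0) := by
    intro m h
    have := hdeg m h
    ext j
    fin_cases j
    · simp
    · simp; omega
  rw [MvPolynomial.aeval_eq_eval₂Hom, MvPolynomial.coe_eval₂Hom, MvPolynomial.eval₂_eq', binaryForm]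
  refine Finset.sum_bij_ne_zero (fun m _ _ ↦ m 0) (fun m h _ ↦ ?_) (fun m h _ m' h' _ e ↦ ?_)
    (fun i hi hne ↦ ?_) (fun m h _ ↦ ?_)
  · have := hdeg m h
    exact Finset.mem_range_succ_iff.mpr (by omega)
  · rw [hm m h, hm m' h', e]
  · refine ⟨Finsupp.single 0 i + Finsupp.single 1 (n - i), ?_, ?_, by simp⟩
    · rw [MvPolynomial.mem_support_iff]
      exact fun h0 ↦ hne (by simp only [h0, map_zero, zero_mul])
    · simpa [Fin.prod_univ_two, mul_assoc] using hne
  · conv_lhs => rw [hm m h]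
    simp [Fin.prod_univ_two, mul_assoc]

lemma MvPolynomial.IsHomogeneous.eval_eq_binaryForm {R : Type*} [CommSemiring R]
    {F : MvPolynomial (Fin 2) R} {n : ℕ} (hF : F.IsHomogeneous n) (x y : R) :
    MvPolynomial.eval ![x, y] F = binaryForm
      (fun i ↦ F.coeff (Finsupp.single 0 i + Finsupp.single 1 (n - i))) n x y := by
  simpa [MvPolynomial.aeval_eq_eval] using hF.aeval_eq_binaryForm x y

end BinaryForms

/-! ### Linear factors at finite places -/

section Valuations

variable {M Γ₀ : Type*} [Field M] [LinearOrderedCommGroupWithZero Γ₀] (v : Valuation M Γ₀)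

/-- The root lies in the valuation ring, so the linear factor splits off there and the cofactor has
valuation at most `1`. -/
lemma Valuation.map_binaryForm_le_of_root_le_one {c : ℕ → M} (hc : ∀ i, v (c i) ≤ 1) {n : ℕ}
    {α x y : M} (hx : v x ≤ 1) (hy : v y ≤ 1) (hα : v α ≤ 1) (h : binaryForm c n α 1 = 0) :
    v (binaryForm c n x y) ≤ v (x - α * y) := by
  let c' : ℕ → v.integer := fun i ↦ ⟨c i, hc i⟩
  have hc' : v.integer.subtype ∘ c' = c := rfl
  have h' : binaryForm c' n (⟨α, hα⟩ : v.integer) 1 = 0 := by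
    apply Subtype.val_injective
    exact (map_binaryForm v.integer.subtype c' n _ _).trans h
  obtain ⟨g, hg⟩ := sub_mul_dvd_binaryForm h' ⟨x, hx⟩ ⟨y, hy⟩
  have hg' := congrArg v.integer.subtype hg
  rw [map_binaryForm, map_mul] at hg'
  have : binaryForm c n x y = (x - α * y) * g := hg'
  rw [this, map_mul]
  exact mul_le_of_le_one_right' g.2

/-- This is the local integrality of `F(p) ℓ(q) / ℓ(p)`, with no assumption on the leading
coefficient. If `v α > 1`, reverse the form: `α⁻¹` is a root in the valuation ring, and the factor
`-α` relating the two linear factors appears on both sides. -/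
lemma Valuation.map_binaryForm_mul_le {c : ℕ → M} (hc : ∀ i, v (c i) ≤ 1) {n : ℕ}
    {α x y x' y' : M} (hx : v x ≤ 1) (hy : v y ≤ 1) (hx' : v x' ≤ 1) (hy' : v y' ≤ 1)
    (h : binaryForm c n α 1 = 0) :
    v (binaryForm c n x y) * v (x' - α * y') ≤ v (x - α * y) := by
  have hle : ∀ {z w a : M}, v z ≤ 1 → v w ≤ 1 → v a ≤ 1 → v (z - a * w) ≤ 1 := fun hz hw ha ↦
    (v.map_sub _ _).trans (max_le hz (by rw [map_mul]; exact mul_le_one' ha hw))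
  rcases le_or_gt (v α) 1 with hα | hα
  · exact (mul_le_of_le_one_right' (hle hx' hy' hα)).trans
      (v.map_binaryForm_le_of_root_le_one hc hx hy hα h)
  · have hα0 : α ≠ 0 := by rintro rfl; simp at hα
    have hα' : v α⁻¹ ≤ 1 := by rw [map_inv₀]; exact inv_le_one_of_one_le₀ hα.le
    have h' : binaryForm (fun i ↦ c (n - i)) n α⁻¹ 1 = 0 := by
      have := binaryForm_mul_mul c n α⁻¹ α 1
      rw [inv_mul_cancel₀ hα0, mul_one, h, mul_zero] at this
      rw [binaryForm_swap, this]
    have key := v.map_binaryForm_le_of_root_le_one (fun i ↦ hc (n - i)) hy hx hα' h'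
    rw [binaryForm_swap] at key
    have e : ∀ z w : M, z - α * w = -α * (w - α⁻¹ * z) := fun z w ↦ by field_simp; ring
    rw [e x y, e x' y', map_mul, map_mul, mul_left_comm]
    gcongr
    exact (mul_le_of_le_one_right' (hle hy' hx' hα')).trans key

end Valuations

/-! ### Products over infinite places, and norms -/

section InfinitePlaces

variable {K : Type*} [Field K] [NumberField K]

lemma NumberField.InfinitePlace.prod_embeddings_mk {N : Type*} [CommMonoid N]
    (f : InfinitePlace K → N) :
    ∏ φ : K →+* ℂ, f (InfinitePlace.mk φ) = ∏ v : InfinitePlace K, f v ^ v.mult := by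
  classical
  rw [← Finset.prod_fiberwise Finset.univ InfinitePlace.mk]
  refine Finset.prod_congr rfl fun v _ ↦ ?_
  rw [Finset.prod_congr rfl (g := fun _ ↦ f v) (by simp +contextual), Finset.prod_const,
    ← InfinitePlace.card_filter_mk_eq]

variable {M : Type*} [Field M] [NumberField M] [Algebra K M]

/-- Each embedding of `K` extends to `M` in `[M : K]` ways. -/
lemma NumberField.prod_embeddings_comp_algebraMap {N : Type*} [CommMonoid N]
    (g : (K →+* ℂ) → N) :
    ∏ τ : M →+* ℂ, g (τ.comp (algebraMap K M)) = (∏ σ, g σ) ^ Module.finrank K M := by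
  classical
  rw [← Finset.prod_fiberwise Finset.univ (fun τ : M →+* ℂ ↦ τ.comp (algebraMap K M)),
    ← Finset.prod_pow]
  refine Finset.prod_congr rfl fun σ _ ↦ ?_
  rw [Finset.prod_congr rfl (g := fun _ ↦ g σ) (by simp +contextual), Finset.prod_const]
  congr 1
  let := σ.toAlgebra
  rw [← AlgHom.card K M ℂ, ← Fintype.card_subtype]
  refine Fintype.card_congr ⟨fun τ ↦ ⟨τ.1, fun x ↦ DFunLike.congr_fun τ.2 x⟩,
    fun τ ↦ ⟨τ.toRingHom, RingHom.ext fun x ↦ τ.commutes x⟩, fun _ ↦ rfl, fun _ ↦ rfl⟩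

lemma NumberField.InfinitePlace.prod_comap_pow_mult {N : Type*} [CommMonoid N]
    (f : InfinitePlace K → N) :
    ∏ w : InfinitePlace M, f (w.comap (algebraMap K M)) ^ w.mult =
      (∏ v, f v ^ v.mult) ^ Module.finrank K M := by
  rw [← prod_embeddings_mk, ← prod_embeddings_mk f,
    ← prod_embeddings_comp_algebraMap]
  rfl

lemma NumberField.InfinitePlace.prod_const_pow_mult {N : Type*} [CommMonoid N] (a : N) :
    ∏ v : InfinitePlace K, a ^ v.mult = a ^ Module.finrank ℚ K := by
  rw [Finset.prod_pow_eq_pow_sum, InfinitePlace.sum_mult_eq]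

lemma NumberField.RingOfIntegers.prod_infinitePlace_eq_absNorm (x : 𝓞 K) :
    ∏ v : InfinitePlace K, v (x : K) ^ v.mult = absNorm x := by
  rw [InfinitePlace.prod_eq_abs_norm, ← Algebra.coe_norm_int, absNorm, Nat.cast_natAbs]
  push_cast
  rfl

lemma absNorm_ne_zero {x : 𝓞 K} (hx : x ≠ 0) : absNorm x ≠ 0 := by
  rw [absNorm, Int.natAbs_ne_zero, Algebra.norm_ne_zero_iff]
  exact hx

lemma one_le_absNorm {x : 𝓞 K} (hx : x ≠ 0) : (1 : ℝ) ≤ absNorm x := by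
  exact_mod_cast Nat.one_le_iff_ne_zero.mpr (absNorm_ne_zero hx)

lemma absNorm_mul (x y : 𝓞 K) : absNorm (x * y) = absNorm x * absNorm y := by
  simp [absNorm, Int.natAbs_mul]

lemma absNorm_pow (x : 𝓞 K) (k : ℕ) : absNorm (x ^ k) = absNorm x ^ k := by
  simp [absNorm, Int.natAbs_pow]

lemma absNorm_eq_one_of_isUnit {x : 𝓞 K} (hx : IsUnit x) : absNorm x = 1 :=
  Int.isUnit_iff_natAbs_eq.mp (hx.map (Algebra.norm ℤ))

lemma absNorm_le_of_dvd {x y : 𝓞 K} (hy : y ≠ 0) (h : x ∣ y) : absNorm x ≤ absNorm y := by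
  obtain ⟨z, rfl⟩ := h
  rw [absNorm_mul]
  exact Nat.le_mul_of_pos_right _ (Nat.pos_of_ne_zero (absNorm_ne_zero (right_ne_zero_of_mul hy)))

lemma absNorm_algebraMap (x : 𝓞 K) :
    absNorm (algebraMap (𝓞 K) (𝓞 M) x) = absNorm x ^ Module.finrank K M := by
  have h : ((absNorm (algebraMap (𝓞 K) (𝓞 M) x) : ℕ) : ℝ) = (absNorm x ^ Module.finrank K M : ℕ) := by
    rw [← RingOfIntegers.prod_infinitePlace_eq_absNorm, Nat.cast_pow,
      ← RingOfIntegers.prod_infinitePlace_eq_absNorm,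
      ← InfinitePlace.prod_comap_pow_mult (M := M) fun v ↦ v (x : K)]
    rfl
  exact_mod_cast h

end InfinitePlaces

/-! ### Heights of integral points -/

section Heights

variable {K : Type*} [Field K] [NumberField K]

lemma mulHeight₁_eq_prod_infinitePlace (x : 𝓞 K) :
    Height.mulHeight₁ (x : K) = ∏ v : InfinitePlace K, max (v (x : K)) 1 ^ v.mult := by
  rw [NumberField.mulHeight₁_eq, finprod_eq_one_of_forall_eq_one, mul_one]
  intro v
  refine max_eq_right ?_
  rw [← FinitePlace.norm_embedding_eq]
  exact FinitePlace.norm_le_one K _ x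

/-- The coordinates generate the unit ideal, so the finite places contribute `1`. -/
lemma mulHeight_eq_prod_infinitePlace {ι : Type*} [Finite ι] (x : ι → 𝓞 K)
    (h : ∃ i, IsUnit (x i)) :
    Height.mulHeight (fun i ↦ (x i : K)) =
      ∏ v : InfinitePlace K, (⨆ i, v (x i : K)) ^ v.mult := by
  obtain ⟨i, hi⟩ := h
  have hx : x ≠ 0 := fun h ↦ by simp [h] at hi
  have hx' : (fun i ↦ (x i : K)) ≠ 0 := fun h ↦ hi.ne_zero (by simpa using congrFun h i)
  have := absNorm_mul_finprod_finitePlace_eq_one hx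
  rw [Ideal.eq_top_of_isUnit_mem _ (Ideal.subset_span (Set.mem_range_self i)) hi, Ideal.absNorm_top,
    Nat.cast_one, one_mul] at this
  rw [NumberField.mulHeight_eq hx', this, mul_one]

end Heights

/-! ### Archimedean estimates for forms and roots -/

lemma NumberField.InfinitePlace.sum_le {M : Type*} [Field M] (w : InfinitePlace M) {ι : Type*}
    (s : Finset ι) (f : ι → M) : w (∑ i ∈ s, f i) ≤ ∑ i ∈ s, w (f i) := by
  rw [← InfinitePlace.norm_embedding_eq, map_sum]
  refine (norm_sum_le _ _).trans_eq (Finset.sum_congr rfl fun i _ ↦ ?_)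
  rw [InfinitePlace.norm_embedding_eq]

lemma NumberField.InfinitePlace.apply_neg {M : Type*} [Field M] (w : InfinitePlace M) (x : M) :
    w (-x) = w x :=
  w.1.map_neg x

/-- Cauchy's root bound without division by the leading coefficient: for `|α| > 1`, summing the
geometric series gives `|c n| (|α| - 1) ≤ B`, and `|c n| ≤ B` is then added. -/
lemma NumberField.InfinitePlace.leadingCoeff_mul_max_root_le {M : Type*} [Field M]
    (w : InfinitePlace M) {c : ℕ → M} {n : ℕ} {B : ℝ} (hB : ∀ i ≤ n, w (c i) ≤ B) {α : M}
    (h : binaryForm c n α 1 = 0) : w (c n) * max (w α) 1 ≤ 2 * B := by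
  have hB0 : 0 ≤ B := (apply_nonneg w _).trans (hB n le_rfl)
  rcases le_or_gt (w α) 1 with hα | hα
  · rw [max_eq_right hα, mul_one]
    linarith [hB n le_rfl]
  rw [max_eq_left hα.le]
  have h1 : c n * α ^ n = -∑ i ∈ Finset.range n, c i * α ^ i := by
    simp only [binaryForm, one_pow, mul_one, Finset.sum_range_succ] at h
    linear_combination h
  have h2 : w (c n) * w α ^ n ≤ B * ∑ i ∈ Finset.range n, w α ^ i := by
    rw [← map_pow, ← map_mul, h1, w.apply_neg, Finset.mul_sum]
    refine (w.sum_le _ _).trans (Finset.sum_le_sum fun i hi ↦ ?_)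
    rw [map_mul, map_pow]
    gcongr
    exact hB i (Finset.mem_range.mp hi).le
  have h3 : w (c n) * (w α - 1) * w α ^ n ≤ B * w α ^ n := by
    calc w (c n) * (w α - 1) * w α ^ n = w (c n) * w α ^ n * (w α - 1) := by ring
      _ ≤ B * (∑ i ∈ Finset.range n, w α ^ i) * (w α - 1) :=
        mul_le_mul_of_nonneg_right h2 (by linarith)
      _ = B * (w α ^ n - 1) := by rw [mul_assoc, geom_sum_mul]
      _ ≤ B * w α ^ n := by gcongr; linarith
  have h4 := le_of_mul_le_mul_right h3 (pow_pos (by linarith) n)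
  linarith [hB n le_rfl]

lemma NumberField.InfinitePlace.binaryForm_le {M : Type*} [Field M] (w : InfinitePlace M)
    {c : ℕ → M} {n : ℕ} {B : ℝ} (hB : ∀ i ≤ n, w (c i) ≤ B) (x y : M) :
    w (binaryForm c n x y) ≤ (n + 1) * B * max (w x) (w y) ^ n := by
  refine (w.sum_le _ _).trans ?_
  refine (Finset.sum_le_card_nsmul _ _ (B * max (w x) (w y) ^ n) fun i hi ↦ ?_).trans_eq
    (by rw [Finset.card_range, nsmul_eq_mul]; push_cast; ring)
  have hi := Finset.mem_range_succ_iff.mp hi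
  have hB0 : 0 ≤ B := (apply_nonneg w _).trans (hB n le_rfl)
  rw [map_mul, map_mul, map_pow, map_pow, mul_assoc]
  gcongr
  · exact hB i hi
  · calc w x ^ i * w y ^ (n - i) ≤ max (w x) (w y) ^ i * max (w x) (w y) ^ (n - i) := by
          gcongr
          · exact le_max_left _ _
          · exact le_max_right _ _
      _ = max (w x) (w y) ^ n := by rw [← pow_add, Nat.add_sub_of_le hi]

/-! ### Complex conjugation on the CM-field -/

section CMExtension

variable {K : Type*} [Field K] [NumberField K] [IsTotallyReal K]
  {M : Type*} [Field M] [NumberField M] [IsCMField M] [Algebra K M]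

open IsCMField

omit [NumberField K] in
lemma NumberField.IsCMField.complexConj_algebraMap (x : K) :
    complexConj M (algebraMap K M x) = algebraMap K M x := by
  obtain ⟨φ⟩ : Nonempty (M →+* ℂ) := inferInstance
  apply φ.injective
  rw [complexEmbedding_complexConj]
  exact ComplexEmbedding.conjugate_coe_eq (φ.comp (algebraMap K M)) x ▸ RingHom.congr_fun
    (ComplexEmbedding.isReal_iff.mp (IsTotallyReal.complexEmbedding_isReal
      (φ.comp (algebraMap K M)))) x

omit [NumberField K] in
-- The two conjugate linear factors have equal absolute value at `w`. Eliminating `x` or `y` between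
-- them leaves the other unknown times `α' - α`.
lemma NumberField.IsCMField.infinitePlace_sub_complexConj_mul_max_le (w : InfinitePlace M) (α : M)
    (x y : K) : w (complexConj M α - α) * max (w (algebraMap K M x)) (w (algebraMap K M y)) ≤
      2 * w (algebraMap K M x - α * algebraMap K M y) * max (w α) 1 := by
  set X := algebraMap K M x
  set Y := algebraMap K M y
  have hX : complexConj M X = X := complexConj_algebraMap x
  have hY : complexConj M Y = Y := complexConj_algebraMap y
  have hβ : w (complexConj M (X - α * Y)) = w (X - α * Y) := infinitePlace_complexConj M w _
  have hα : w (complexConj M α) = w α := infinitePlace_complexConj M w _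
  have hβ' : complexConj M (X - α * Y) = X - complexConj M α * Y := by
    rw [map_sub, map_mul, hX, hY]
  rw [hβ'] at hβ
  have hsub : ∀ p q : M, w (p - q) ≤ w p + w q := fun p q ↦ by
    rw [sub_eq_add_neg, ← w.apply_neg q]; exact w.1.add_le p (-q)
  have h0 := apply_nonneg w (X - α * Y)
  rw [mul_max_of_nonneg _ _ (apply_nonneg _ _), ← map_mul, ← map_mul]
  refine max_le ?_ ?_
  · rw [show (complexConj M α - α) * X = (X - α * Y) * complexConj M α -
      (X - complexConj M α * Y) * α by ring]
    refine (hsub _ _).trans ?_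
    rw [map_mul, map_mul, hβ, hα]
    nlinarith [le_max_left (w α) 1]
  · rw [show (complexConj M α - α) * Y = (X - α * Y) - (X - complexConj M α * Y) by ring]
    refine (hsub _ _).trans ?_
    rw [hβ]
    nlinarith [le_max_right (w α) 1]

variable {c : ℕ → 𝓞 K} {n : ℕ} {α : M}

omit [NumberField K] [IsTotallyReal K] [NumberField M] [IsCMField M] in
-- Since `α` need not be integral, the factor is split off the monic form with the integral root `A
-- = c n * α`.
lemma leadingCoeff_mul_sub_dvd (hn : n ≠ 0)
    (hα : binaryForm (algebraMap (𝓞 K) M ∘ c) n α 1 = 0) {A : 𝓞 M}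
    (hA : (A : M) = algebraMap (𝓞 K) M (c n) * α) (x y : 𝓞 K) :
    algebraMap (𝓞 K) (𝓞 M) (c n) * algebraMap (𝓞 K) (𝓞 M) x - A * algebraMap (𝓞 K) (𝓞 M) y ∣
      algebraMap (𝓞 K) (𝓞 M) (c n ^ (n - 1) * binaryForm c n x y) := by
  have hroot : binaryForm (monicCoeff (algebraMap (𝓞 K) (𝓞 M) ∘ c) n) n A 1 = 0 := by
    apply RingOfIntegers.coe_injective
    rw [map_binaryForm, map_monicCoeff, ← RingOfIntegers.coe_eq_algebraMap, hA, map_one, map_zero]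
    have := binaryForm_monicCoeff (algebraMap (𝓞 K) M ∘ c) hn α 1
    rw [hα, mul_zero] at this
    exact this
  have := sub_mul_dvd_binaryForm hroot
    (algebraMap (𝓞 K) (𝓞 M) (c n) * algebraMap (𝓞 K) (𝓞 M) x) (algebraMap (𝓞 K) (𝓞 M) y)
  rw [map_mul, map_pow, map_binaryForm]
  exact this.trans (binaryForm_monicCoeff (algebraMap (𝓞 K) (𝓞 M) ∘ c) hn _ _).dvd

/-- The archimedean part of the height of `(x : y)` for a solution `(x, y)` of `F(x, y) = b`. -/
lemma prod_max_le_of_binaryForm_eq (hn : n ≠ 0) (h0 : c n ≠ 0)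
    (hα : binaryForm (algebraMap (𝓞 K) M ∘ c) n α 1 = 0) (hconj : complexConj M α ≠ α)
    {B : InfinitePlace K → ℝ} (hB : ∀ v, ∀ i ≤ n, v (c i : K) ≤ B v)
    {b x y : 𝓞 K} (hb : b ≠ 0) (hxy : binaryForm c n x y = b) :
    ∏ v : InfinitePlace K, max (v (x : K)) (v (y : K)) ^ v.mult ≤
      4 ^ Module.finrank ℚ K * (∏ v, B v ^ v.mult) * absNorm (c n ^ (n - 1) * b) := by
  have hB0 : ∀ v, 0 ≤ B v := fun v ↦ (apply_nonneg v _).trans (hB v n le_rfl)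
  obtain ⟨A, hA⟩ : ∃ A : 𝓞 M, (A : M) = algebraMap (𝓞 K) M (c n) * α :=
    ⟨⟨_, isIntegral_trans _ (isIntegral_of_binaryForm_eq_zero c n α hα)⟩, rfl⟩
  set β : 𝓞 M := algebraMap (𝓞 K) (𝓞 M) (c n) * algebraMap (𝓞 K) (𝓞 M) x -
    A * algebraMap (𝓞 K) (𝓞 M) y with hβ
  set D : 𝓞 M := ringOfIntegersComplexConj M A - A with hD
  set a : 𝓞 M := algebraMap (𝓞 K) (𝓞 M) (c n) with ha
  have haM : (a : M) = algebraMap K M (c n : K) := rfl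
  have ha0 : a ≠ 0 := (map_ne_zero_iff _ (FaithfulSMul.algebraMap_injective (𝓞 K) (𝓞 M))).mpr h0
  have hAM : (A : M) = a * α := hA
  have hDM : (D : M) = a * (complexConj M α - α) := by
    change complexConj M (A : M) - (A : M) = _
    rw [hAM, map_mul, haM, complexConj_algebraMap]
    ring
  have hD0 : D ≠ 0 := by
    refine RingOfIntegers.coe_ne_zero_iff.mp ?_
    rw [← RingOfIntegers.coe_eq_algebraMap, hDM]
    exact mul_ne_zero (RingOfIntegers.coe_ne_zero_iff.mpr ha0) (sub_ne_zero.mpr hconj)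
  have hβM : (β : M) = a * (algebraMap K M x - α * algebraMap K M y) := by
    rw [mul_sub, ← mul_assoc, ← hAM]
    rfl
  -- One factor `2` comes from the triangle inequality, the other from the root bound; the second
  -- power of `a` clears the denominator of `max (w α) 1`.
  have hw : ∀ w : InfinitePlace M, w (D : M) * w (a : M) *
      max (w (algebraMap K M x)) (w (algebraMap K M y)) ≤
        4 * w (β : M) * B (w.comap (algebraMap K M)) := by
    intro w
    have h1 := infinitePlace_sub_complexConj_mul_max_le w α (x : K) (y : K)
    have h2 : w (a : M) * max (w α) 1 ≤ 2 * B (w.comap (algebraMap K M)) :=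
      w.leadingCoeff_mul_max_root_le (c := algebraMap (𝓞 K) M ∘ c)
        (fun i hi ↦ hB (w.comap (algebraMap K M)) i hi) hα
    have h3 := apply_nonneg w (a : M)
    have h4 := apply_nonneg w (algebraMap K M x - α * algebraMap K M y)
    rw [hDM, hβM, map_mul, map_mul]
    calc _ = w (a : M) * w (a : M) * (w (complexConj M α - α) *
          max (w (algebraMap K M x)) (w (algebraMap K M y))) := by ring
      _ ≤ w (a : M) * w (a : M) * (2 * w (algebraMap K M x - α * algebraMap K M y) *
          max (w α) 1) := by gcongr
      _ = 2 * (w (a : M) * w (algebraMap K M x - α * algebraMap K M y)) *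
          (w (a : M) * max (w α) 1) := by ring
      _ ≤ 2 * (w (a : M) * w (algebraMap K M x - α * algebraMap K M y)) *
          (2 * B (w.comap (algebraMap K M))) := by gcongr
      _ = _ := by ring
  have hprod : ∏ w : InfinitePlace M, (w (D : M) * w (a : M) *
      max (w (algebraMap K M x)) (w (algebraMap K M y))) ^ w.mult ≤
        ∏ w : InfinitePlace M, (4 * w (β : M) * B (w.comap (algebraMap K M))) ^ w.mult := by
    refine Finset.prod_le_prod (fun w _ ↦ by positivity) fun w _ ↦ ?_
    exact pow_le_pow_left₀ (by positivity) (hw w) _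
  simp only [mul_pow, Finset.prod_mul_distrib] at hprod
  rw [RingOfIntegers.prod_infinitePlace_eq_absNorm, RingOfIntegers.prod_infinitePlace_eq_absNorm,
    RingOfIntegers.prod_infinitePlace_eq_absNorm, InfinitePlace.prod_const_pow_mult,
    InfinitePlace.prod_comap_pow_mult] at hprod
  have hmax := InfinitePlace.prod_comap_pow_mult (M := M)
    fun v : InfinitePlace K ↦ max (v (x : K)) (v (y : K))
  simp only [InfinitePlace.comap_apply] at hmax
  rw [hmax] at hprod
  have hdvd := absNorm_le_of_dvd ?_ (leadingCoeff_mul_sub_dvd hn hα hA x y)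
  · rw [hxy, absNorm_algebraMap] at hdvd
    have hβn : (absNorm β : ℝ) ≤ (absNorm (c n ^ (n - 1) * b) : ℝ) ^ Module.finrank K M := by
      rw [← Nat.cast_pow]
      exact Nat.cast_le.mpr hdvd
    -- All quantities coming from `K` occur to the power `[M : K]`, which is now removed.
    refine le_of_pow_le_pow_left₀ (n := Module.finrank K M) Module.finrank_pos.ne'
      (mul_nonneg (mul_nonneg (by positivity) (Finset.prod_nonneg fun v _ ↦ pow_nonneg (hB0 v) _))
        (Nat.cast_nonneg _)) ?_
    have hP : 0 ≤ ∏ v, B v ^ v.mult := Finset.prod_nonneg fun v _ ↦ pow_nonneg (hB0 v) _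
    calc _ ≤ (absNorm D : ℝ) * absNorm a *
          (∏ v : InfinitePlace K, max (v (x : K)) (v (y : K)) ^ v.mult) ^ Module.finrank K M :=
          le_mul_of_one_le_left (by positivity)
            (one_le_mul_of_one_le_of_one_le (one_le_absNorm hD0) (one_le_absNorm ha0))
      _ ≤ _ := hprod
      _ ≤ 4 ^ Module.finrank ℚ M * (absNorm (c n ^ (n - 1) * b) : ℝ) ^ Module.finrank K M *
          (∏ v, B v ^ v.mult) ^ Module.finrank K M := by gcongr
      _ = _ := by
          rw [← Module.finrank_mul_finrank ℚ K M, pow_mul]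
          ring
  · rw [hxy]
    exact (map_ne_zero_iff _ (FaithfulSMul.algebraMap_injective (𝓞 K) (𝓞 M))).mpr
      (mul_ne_zero (pow_ne_zero _ h0) hb)

end CMExtension

/-! ### From the archimedean product to heights -/

section HeightBounds

open IsCMField

variable {K : Type*} [Field K] [NumberField K] [IsTotallyReal K]
  {M : Type*} [Field M] [NumberField M] [IsCMField M] [Algebra K M]
  {c : ℕ → 𝓞 K} {n : ℕ} {α : M}

/-- Places where `max(|x|, |y|)` is small could spoil the passage to `max(|z|, 1)`. There `|b| ≤ (n
+ 1) B max(|x|, |y|) ^ n` compensates, at the cost of a factor `|b|` on the left, whose product is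
`N(b) ≥ 1`. -/
lemma mulHeight₁_pow_le_of_binaryForm_eq (hn : n ≠ 0) (h0 : c n ≠ 0)
    (hα : binaryForm (algebraMap (𝓞 K) M ∘ c) n α 1 = 0) (hconj : complexConj M α ≠ α)
    {B : InfinitePlace K → ℝ} (hB1 : ∀ v, 1 ≤ B v) (hB : ∀ v, ∀ i ≤ n, v (c i : K) ≤ B v)
    {b x y z : 𝓞 K} (hb : b ≠ 0) (hxy : binaryForm c n x y = b)
    (hz : ∀ v : InfinitePlace K, v (z : K) ≤ max (v (x : K)) (v (y : K))) :
    Height.mulHeight₁ (z : K) ^ n ≤ Height.mulHeight₁ (b : K) * (n + 1) ^ Module.finrank ℚ K *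
      (∏ v, B v ^ v.mult) * (4 ^ Module.finrank ℚ K * (∏ v, B v ^ v.mult) *
        absNorm (c n ^ (n - 1) * b)) ^ n := by
  have hv : ∀ v : InfinitePlace K, v (b : K) * max (v (z : K)) 1 ^ n ≤
      max (v (b : K)) 1 * (n + 1) * B v * max (v (x : K)) (v (y : K)) ^ n := by
    intro v
    have h1 : v (b : K) ≤ (n + 1) * B v * max (v (x : K)) (v (y : K)) ^ n := by
      have := v.binaryForm_le (c := algebraMap (𝓞 K) K ∘ c) (hB v) (x : K) (y : K)
      rwa [← hxy, RingOfIntegers.coe_eq_algebraMap, map_binaryForm]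
    have h2 : (1 : ℝ) ≤ (n + 1) * B v :=
      one_le_mul_of_one_le_of_one_le (by linarith [n.cast_nonneg (α := ℝ)]) (hB1 v)
    set m := max (v (x : K)) (v (y : K)) with hm
    have hm0 : 0 ≤ m ^ n := pow_nonneg (le_max_of_le_left (apply_nonneg v _)) n
    have hb0 : 0 ≤ v (b : K) := apply_nonneg v _
    rcases le_total (v (z : K)) 1 with h | h
    · rw [max_eq_right h, one_pow, mul_one, mul_assoc, mul_assoc, ← mul_assoc ((n : ℝ) + 1)]
      exact h1.trans (le_mul_of_one_le_left (by positivity) (le_max_right _ _))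
    · rw [max_eq_left h, mul_assoc (max _ _)]
      calc v (b : K) * v (z : K) ^ n ≤ max (v (b : K)) 1 * 1 * m ^ n := by
            rw [mul_one]
            gcongr
            · exact le_max_left _ _
            · exact hz v
        _ ≤ _ := by gcongr
  have hprod : ∏ v : InfinitePlace K, (v (b : K) * max (v (z : K)) 1 ^ n) ^ v.mult ≤
      ∏ v : InfinitePlace K,
        (max (v (b : K)) 1 * (n + 1) * B v * max (v (x : K)) (v (y : K)) ^ n) ^ v.mult :=
    Finset.prod_le_prod (fun v _ ↦ by positivity)
      fun v _ ↦ pow_le_pow_left₀ (by positivity) (hv v) _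
  simp only [mul_pow, Finset.prod_mul_distrib, ← pow_mul, mul_comm n] at hprod
  simp only [pow_mul, Finset.prod_pow] at hprod
  rw [RingOfIntegers.prod_infinitePlace_eq_absNorm, ← mulHeight₁_eq_prod_infinitePlace,
    ← mulHeight₁_eq_prod_infinitePlace, InfinitePlace.prod_const_pow_mult] at hprod
  have hP : 0 ≤ ∏ v, B v ^ v.mult :=
    Finset.prod_nonneg fun v _ ↦ pow_nonneg (zero_le_one.trans (hB1 v)) _
  have hz0 := Height.mulHeight₁_nonneg (z : K)
  have hb0 := Height.mulHeight₁_nonneg (b : K)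
  refine (le_mul_of_one_le_left (by positivity) (one_le_absNorm hb)).trans (hprod.trans ?_)
  gcongr
  exact prod_max_le_of_binaryForm_eq hn h0 hα hconj hB hb hxy

omit [IsTotallyReal K] in
lemma absHeight_pow_finrank (x : 𝓞 K) :
    absHeight x ^ Module.finrank ℚ K = Height.mulHeight₁ (x : K) := by
  rw [absHeight, one_div, Real.rpow_inv_natCast_pow (Height.mulHeight₁_nonneg _)
    Module.finrank_pos.ne']

omit [IsTotallyReal K] in
lemma one_le_absHeight (x : 𝓞 K) : 1 ≤ absHeight x :=
  Real.one_le_rpow (Height.one_le_mulHeight₁ _) (by positivity)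

lemma absHeight_le_of_binaryForm_eq (hn : n ≠ 0) (h0 : c n ≠ 0)
    (hα : binaryForm (algebraMap (𝓞 K) M ∘ c) n α 1 = 0) (hconj : complexConj M α ≠ α)
    {B : InfinitePlace K → ℝ} (hB1 : ∀ v, 1 ≤ B v) (hB : ∀ v, ∀ i ≤ n, v (c i : K) ≤ B v)
    {b x y z : 𝓞 K} (hb : b ≠ 0) (hxy : binaryForm c n x y = b)
    (hz : ∀ v : InfinitePlace K, v (z : K) ≤ max (v (x : K)) (v (y : K)))
    {h : ℝ} (hh0 : 0 < h) (hh : h ^ Module.finrank ℚ K = ∏ v, B v ^ v.mult) :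
    absHeight z ≤ 8 * absHeight b ^ (1 / (n : ℝ)) * h ^ (1 + 1 / (n : ℝ)) *
      (absNorm (c n ^ (n - 1) * b) : ℝ) ^ (1 / (Module.finrank ℚ K : ℝ)) := by
  have hd := (Module.finrank_pos (R := ℚ) (M := K)).ne'
  have hb0 := zero_le_one.trans (one_le_absHeight b)
  have key := mulHeight₁_pow_le_of_binaryForm_eq hn h0 hα hconj hB1 hB hb hxy hz
  rw [← absHeight_pow_finrank, ← absHeight_pow_finrank, ← hh] at key
  rw [Real.rpow_add hh0, Real.rpow_one]
  set d := Module.finrank ℚ K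
  have e1 : (absHeight b ^ (1 / (n : ℝ))) ^ n = absHeight b := by
    rw [one_div, Real.rpow_inv_natCast_pow hb0 hn]
  have e2 : (h ^ (1 / (n : ℝ))) ^ n = h := by
    rw [one_div, Real.rpow_inv_natCast_pow hh0.le hn]
  have e3 : ((absNorm (c n ^ (n - 1) * b) : ℝ) ^ (1 / (d : ℝ))) ^ d =
      absNorm (c n ^ (n - 1) * b) := by
    rw [one_div, Real.rpow_inv_natCast_pow (Nat.cast_nonneg _) hd]
  have hb1 : 0 ≤ absHeight b ^ (1 / (n : ℝ)) := Real.rpow_nonneg hb0 _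
  have hh1 : 0 ≤ h ^ (1 / (n : ℝ)) := Real.rpow_nonneg hh0.le _
  have hN1 : 0 ≤ (absNorm (c n ^ (n - 1) * b) : ℝ) ^ (1 / (d : ℝ)) :=
    Real.rpow_nonneg (Nat.cast_nonneg _) _
  generalize (absNorm (c n ^ (n - 1) * b) : ℝ) ^ (1 / (d : ℝ)) = N' at *
  generalize h ^ (1 / (n : ℝ)) = h' at *
  generalize absHeight b ^ (1 / (n : ℝ)) = b' at *
  refine le_of_pow_le_pow_left₀ (n := d * n) (mul_ne_zero hd hn) (by positivity) ?_
  rw [pow_mul]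
  refine key.trans ?_
  rw [← e3, ← e1]
  -- After the `n`-th root this costs a factor `2`, so the constant is `8 = 2 * 4`.
  have h2 : ((n : ℝ) + 1) ≤ 2 ^ n := by exact_mod_cast Nat.succ_le_of_lt Nat.lt_two_pow_self
  calc _ ≤ (b' ^ n) ^ d * (2 ^ n) ^ d * h ^ d * (4 ^ d * h ^ d * N' ^ d) ^ n := by gcongr
    _ = (b' ^ n) ^ d * (2 ^ n) ^ d * (h' ^ n) ^ d * (4 ^ d * h ^ d * N' ^ d) ^ n := by rw [e2]
    _ = (8 * b' * (h * h') * N') ^ (d * n) := by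
      have h8 : (8 : ℝ) ^ (d * n) = 2 ^ (d * n) * 4 ^ (d * n) := by rw [← mul_pow]; norm_num
      rw [mul_assoc 8, mul_assoc 8, mul_pow 8, h8]
      ring

end HeightBounds

/-! ### Fibrewise counting and roots of unity -/

lemma Set.finite_and_ncard_le_mul {S T : Type*} [Finite T] (s : Set S) (f : S → T) {k : ℕ}
    (h : ∀ p ∈ s, {q ∈ s | f q = f p}.Finite ∧ {q ∈ s | f q = f p}.ncard ≤ k) :
    s.Finite ∧ s.ncard ≤ k * Nat.card T := by
  classical
  have := Fintype.ofFinite T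
  have hs : s.Finite := by
    refine Set.Finite.of_finite_fibers f (Set.toFinite _) ?_
    rintro _ ⟨p, hp, rfl⟩
    exact (h p hp).1
  refine ⟨hs, ?_⟩
  rw [Set.ncard_eq_toFinset_card s hs, Nat.card_eq_fintype_card]
  refine (Finset.card_le_mul_card_image (f := f) _ k fun t ht ↦ ?_).trans
    (Nat.mul_le_mul_left k (Finset.card_le_univ _))
  obtain ⟨p, hp, rfl⟩ := Finset.mem_image.mp ht
  have hp := hs.mem_toFinset.mp hp
  refine le_of_eq_of_le ?_ (h p hp).2
  rw [← Set.ncard_coe_finset]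
  congr 1
  ext q
  simp

section RootsOfUnity

variable (M : Type*) [Field M] [NumberField M]

omit [NumberField M] in
lemma numRootsOfUnity_eq_card_torsion : numRootsOfUnity M = Nat.card (Units.torsion M) := by
  refine (Nat.card_congr (Equiv.ofBijective
    (fun u : Units.torsion M ↦ (⟨((u : (𝓞 M)ˣ) : M), ?_⟩ : {ζ : M // ∃ k : ℕ, 0 < k ∧ ζ ^ k = 1}))
    ⟨fun u u' h ↦ ?_, ?_⟩)).symm
  · obtain ⟨k, hk, h⟩ := isOfFinOrder_iff_pow_eq_one.mp ((CommGroup.mem_torsion _).mp u.2)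
    exact ⟨k, hk, by simpa using congrArg (fun u : (𝓞 M)ˣ ↦ (u : M)) h⟩
  · simp only [Subtype.mk.injEq] at h
    exact Subtype.ext (Units.ext (RingOfIntegers.ext h))
  · rintro ⟨ζ, k, hk, hζ⟩
    let z : 𝓞 M := ⟨ζ, IsIntegral.of_pow hk (hζ ▸ isIntegral_one)⟩
    have hz : z ^ k = 1 := RingOfIntegers.ext hζ
    let u : (𝓞 M)ˣ := Units.ofPowEqOne z k hz hk.ne'
    exact ⟨⟨u, (CommGroup.mem_torsion _).mpr (isOfFinOrder_iff_pow_eq_one.mpr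
      ⟨k, hk, Units.pow_ofPowEqOne hz hk.ne'⟩)⟩, rfl⟩

/-- Roots of unity are distinct modulo `3`: a difference of two has absolute value at most `2` at
every infinite place, whereas a nonzero multiple of `3` has norm at least `3 ^ [M : ℚ]`. -/
lemma card_torsion_le : Nat.card (Units.torsion M) ≤ 3 ^ Module.finrank ℚ M := by
  let I : Ideal (𝓞 M) := Ideal.span {(3 : 𝓞 M)}
  have h3 : absNorm (3 : 𝓞 M) = 3 ^ Module.finrank ℚ M := by
    have := Algebra.norm_algebraMap (R := ℤ) (S := 𝓞 M) 3
    rw [RingOfIntegers.rank] at this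
    rw [absNorm, show (3 : 𝓞 M) = algebraMap ℤ (𝓞 M) 3 by simp, this, Int.natAbs_pow]
    rfl
  have hI : Nat.card (𝓞 M ⧸ I) = 3 ^ Module.finrank ℚ M := by
    rw [← h3, absNorm, ← Ideal.absNorm_span_singleton, Ideal.absNorm_apply,
      Submodule.cardQuot_apply]
  have : Finite (𝓞 M ⧸ I) := Nat.finite_of_card_ne_zero (hI ▸ by positivity)
  rw [← hI]
  refine Nat.card_le_card_of_injective
    (fun u : Units.torsion M ↦ Ideal.Quotient.mk I ((u : (𝓞 M)ˣ) : 𝓞 M)) fun u u' h ↦ ?_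
  have hdvd := Ideal.mem_span_singleton.mp (Ideal.Quotient.eq.mp h)
  by_contra hne
  have h0 : (((u : (𝓞 M)ˣ) : 𝓞 M) - ((u' : (𝓞 M)ˣ) : 𝓞 M)) ≠ 0 :=
    fun h ↦ hne (Subtype.ext (Units.ext (sub_eq_zero.mp h)))
  have hle := absNorm_le_of_dvd h0 hdvd
  rw [h3] at hle
  have hub : (absNorm (((u : (𝓞 M)ˣ) : 𝓞 M) - ((u' : (𝓞 M)ˣ) : 𝓞 M)) : ℝ) ≤
      2 ^ Module.finrank ℚ M := by
    rw [← RingOfIntegers.prod_infinitePlace_eq_absNorm,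
      ← InfinitePlace.prod_const_pow_mult (K := M)]
    refine Finset.prod_le_prod (fun w _ ↦ by positivity) fun w _ ↦ ?_
    refine pow_le_pow_left₀ (apply_nonneg w _) ?_ _
    have h1 := (Units.mem_torsion M).mp u.2 w
    have h2 := (Units.mem_torsion M).mp u'.2 w
    rw [RingOfIntegers.coe_eq_algebraMap, map_sub, sub_eq_add_neg]
    refine (w.1.add_le _ _).trans ?_
    change w _ + w _ ≤ 2
    rw [w.apply_neg, h1, h2]
    norm_num
  have hub' : absNorm (((u : (𝓞 M)ˣ) : 𝓞 M) - ((u' : (𝓞 M)ˣ) : 𝓞 M)) ≤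
      2 ^ Module.finrank ℚ M := by exact_mod_cast hub
  exact absurd (hle.trans hub')
    (Nat.pow_lt_pow_left (by norm_num) Module.finrank_pos.ne').not_ge

end RootsOfUnity

/-! ### Counting solutions -/

section Counting

open IsCMField

variable {K : Type*} [Field K] [NumberField K] [IsTotallyReal K]
  {M : Type*} [Field M] [NumberField M] [IsCMField M] [Algebra K M]
  {c : ℕ → 𝓞 K} {n : ℕ} {α : M}

/-- The linear factor `x - α * y` of the form. -/
def linearFactor (α : M) (p : 𝓞 K × 𝓞 K) : M :=
  algebraMap (𝓞 K) M p.1 - α * algebraMap (𝓞 K) M p.2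

omit [NumberField K] [IsTotallyReal K] [NumberField M] [IsCMField M] in
lemma linearFactor_ne_zero (hα : binaryForm (algebraMap (𝓞 K) M ∘ c) n α 1 = 0)
    {p : 𝓞 K × 𝓞 K} (hp : binaryForm c n p.1 p.2 ≠ 0) : linearFactor α p ≠ 0 := by
  intro h
  have hdvd := sub_mul_dvd_binaryForm hα (algebraMap (𝓞 K) M p.1) (algebraMap (𝓞 K) M p.2)
  rw [show algebraMap (𝓞 K) M p.1 - α * algebraMap (𝓞 K) M p.2 = 0 from h, zero_dvd_iff,
    ← map_binaryForm] at hdvd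
  exact hp ((map_eq_zero_iff _ (FaithfulSMul.algebraMap_injective (𝓞 K) M)).mp hdvd)

omit [NumberField K] [IsTotallyReal K] [IsCMField M] in
lemma exists_mul_linearFactor_eq (hα : binaryForm (algebraMap (𝓞 K) M ∘ c) n α 1 = 0)
    {p : 𝓞 K × 𝓞 K} (hp : binaryForm c n p.1 p.2 ≠ 0) (q : 𝓞 K × 𝓞 K) :
    ∃ θ : 𝓞 M, (θ : M) * linearFactor α p =
      algebraMap (𝓞 K) M (binaryForm c n p.1 p.2) * linearFactor α q := by
  have h0 := linearFactor_ne_zero hα hp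
  obtain ⟨θ, hθ⟩ := IsDedekindDomain.HeightOneSpectrum.mem_integers_of_valuation_le_one
    (R := 𝓞 M) M
    (algebraMap (𝓞 K) M (binaryForm c n p.1 p.2) * linearFactor α q / linearFactor α p)
    fun v ↦ by
      have hint : ∀ z : 𝓞 K, v.valuation M (algebraMap (𝓞 K) M z) ≤ 1 := fun z ↦
        v.valuation_le_one (algebraMap (𝓞 K) (𝓞 M) z)
      rw [map_div₀, map_mul, map_binaryForm]
      refine div_le_one_of_le₀ ?_ zero_le
      exact (v.valuation M).map_binaryForm_mul_le (fun i ↦ hint (c i)) (hint _) (hint _)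
        (hint _) (hint _) hα
  exact ⟨θ, by rw [RingOfIntegers.coe_eq_algebraMap, hθ, div_mul_cancel₀ _ h0]⟩

omit [NumberField K] in
/-- A solution is determined up to sign by its linear factor up to real multiples. -/
lemma eq_or_eq_neg_of_linearFactor_eq_mul (hconj : complexConj M α ≠ α) (hn : n ≠ 0)
    {b : 𝓞 K} (hb : b ≠ 0) {p q : 𝓞 K × 𝓞 K} (hp : binaryForm c n p.1 p.2 = b)
    (hq : binaryForm c n q.1 q.2 = b) {r : M} (hr : complexConj M r = r)
    (h : linearFactor α p = r * linearFactor α q) : p = q ∨ p = -q := by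
  have hc : ∀ z : 𝓞 K, complexConj M (algebraMap (𝓞 K) M z) = algebraMap (𝓞 K) M z := fun z ↦
    complexConj_algebraMap (z : K)
  have hinj := FaithfulSMul.algebraMap_injective (𝓞 K) M
  have h' := congrArg (complexConj M) h
  simp only [linearFactor, map_sub, map_mul, hc, hr] at h h'
  -- Subtracting the conjugate relation eliminates the first coordinate.
  have hy : algebraMap (𝓞 K) M p.2 = r * algebraMap (𝓞 K) M q.2 :=
    mul_left_cancel₀ (sub_ne_zero.mpr hconj) (by linear_combination h - h')
  have hx : algebraMap (𝓞 K) M p.1 = r * algebraMap (𝓞 K) M q.1 := by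
    linear_combination h + α * hy
  -- Both points represent the same `b ≠ 0` and the form is homogeneous of degree `n`.
  have hrn : r ^ n = 1 := by
    have h1 := map_binaryForm (algebraMap (𝓞 K) M) c n p.1 p.2
    rw [hx, hy, binaryForm_mul_mul, ← map_binaryForm, hp, hq] at h1
    exact (mul_eq_right₀ ((map_ne_zero_iff _ hinj).mpr hb)).mp h1.symm
  have hr1 : r = 1 ∨ r = -1 := by
    obtain ⟨φ⟩ : Nonempty (M →+* ℂ) := inferInstance
    have hφ : (starRingEnd ℂ) (φ r) = φ r := by rw [← complexEmbedding_complexConj, hr]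
    obtain ⟨t, ht⟩ := Complex.conj_eq_iff_real.mp hφ
    have htn : |t| ^ n = 1 := by
      have : (t : ℂ) ^ n = 1 := by rw [← ht, ← map_pow, hrn, map_one]
      rw [← abs_pow, (by exact_mod_cast this : t ^ n = 1), abs_one]
    have ht1 : |t| = 1 := (pow_eq_one_iff_of_nonneg (abs_nonneg t) hn).mp htn
    rcases (abs_eq zero_le_one).mp ht1 with rfl | rfl
    · exact .inl (φ.injective (by rw [ht, map_one, Complex.ofReal_one]))
    · exact .inr (φ.injective (by rw [ht, map_neg, map_one, Complex.ofReal_neg,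
        Complex.ofReal_one]))
  rcases hr1 with rfl | rfl
  · exact .inl (Prod.ext (hinj (by rw [hx, one_mul])) (hinj (by rw [hy, one_mul])))
  · exact .inr (Prod.ext (hinj (by rw [hx, Prod.fst_neg, map_neg, neg_one_mul]))
      (hinj (by rw [hy, Prod.snd_neg, map_neg, neg_one_mul])))

/-- The number of solutions of `F(x, y) = b`, with `F` given by the coefficients `c`. -/
theorem finite_and_ncard_binaryForm_le (hn : n ≠ 0)
    (hα : binaryForm (algebraMap (𝓞 K) M ∘ c) n α 1 = 0) (hconj : complexConj M α ≠ α)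
    {b : 𝓞 K} (hb : b ≠ 0) :
    {p : 𝓞 K × 𝓞 K | binaryForm c n p.1 p.2 = b}.Finite ∧
    {p : 𝓞 K × 𝓞 K | binaryForm c n p.1 p.2 = b}.ncard ≤
      2 * numRootsOfUnity M * absNorm b ^ (2 * Module.finrank K M) := by
  classical
  set S := {p : 𝓞 K × 𝓞 K | binaryForm c n p.1 p.2 = b}
  rcases S.eq_empty_or_nonempty with hS | ⟨p₀, hp₀⟩
  · simp [hS]
  have hne : ∀ p ∈ S, binaryForm c n p.1 p.2 ≠ 0 := fun p hp ↦ by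
    rw [show binaryForm c n p.1 p.2 = b from hp]; exact hb
  have hlin : ∀ p ∈ S, linearFactor α p ≠ 0 := fun p hp ↦ linearFactor_ne_zero hα (hne p hp)
  set bM : 𝓞 M := algebraMap (𝓞 K) (𝓞 M) b with hbM
  have hbM0 : bM ≠ 0 := (map_ne_zero_iff _ (FaithfulSMul.algebraMap_injective (𝓞 K) (𝓞 M))).mpr hb
  have hbM0' : (bM : M) ≠ 0 := RingOfIntegers.coe_ne_zero_iff.mpr hbM0
  have hex : ∀ p ∈ S, ∀ q, ∃ θ : 𝓞 M,
      (θ : M) * linearFactor α p = bM * linearFactor α q := fun p hp q ↦ by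
    obtain ⟨θ, hθ⟩ := exists_mul_linearFactor_eq hα (hne p hp) q
    rw [show binaryForm c n p.1 p.2 = b from hp] at hθ
    exact ⟨θ, hθ⟩
  -- `θ p` is `b ℓ(p₀) / ℓ(p)` on solutions; elsewhere its value is irrelevant.
  have hθex : ∀ p, ∃ θ : 𝓞 M, p ∈ S → (θ : M) * linearFactor α p = bM * linearFactor α p₀ :=
    fun p ↦ by
      by_cases hp : p ∈ S
      · obtain ⟨θ, hθ⟩ := hex p hp p₀
        exact ⟨θ, fun _ ↦ hθ⟩
      · exact ⟨0, fun h ↦ absurd h hp⟩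
  choose θ hθ using hθex
  -- The complementary divisor is `b ℓ(p) / ℓ(p₀)`.
  have hdvd : ∀ p ∈ S, θ p ∣ bM ^ 2 := fun p hp ↦ by
    obtain ⟨η, hη⟩ := hex p₀ hp₀ p
    refine ⟨η, RingOfIntegers.ext ?_⟩
    refine mul_right_cancel₀ (mul_ne_zero (hlin p hp) (hlin p₀ hp₀)) ?_
    simp only [map_pow, map_mul]
    linear_combination -(η : M) * linearFactor α p₀ * hθ p hp - bM * linearFactor α p₀ * hη
  let I : Ideal (𝓞 M) := Ideal.span {bM ^ 2}
  have hI : Nat.card (𝓞 M ⧸ I) = absNorm b ^ (2 * Module.finrank K M) := by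
    rw [mul_comm 2, pow_mul, ← absNorm_algebraMap (M := M), ← absNorm_pow, ← hbM, absNorm,
      ← Ideal.absNorm_span_singleton, Ideal.absNorm_apply, Submodule.cardQuot_apply]
  have hfin : Finite (𝓞 M ⧸ I) :=
    Nat.finite_of_card_ne_zero (hI ▸ pow_ne_zero _ (absNorm_ne_zero hb))
  rw [← hI]
  refine Set.finite_and_ncard_le_mul S (fun p ↦ Ideal.Quotient.mk I (θ p)) fun p₁ hp₁ ↦ ?_
  set T := {q ∈ S | Ideal.Quotient.mk I (θ q) = Ideal.Quotient.mk I (θ p₁)} with hT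
  have hunit : ∀ p, ∃ u : (𝓞 M)ˣ, p ∈ T →
      linearFactor α p = ((u : 𝓞 M) : M) * linearFactor α p₁ := fun p ↦ by
    by_cases hp : p ∈ T
    swap
    · exact ⟨1, fun h ↦ absurd h hp⟩
    obtain ⟨hpS, hpI⟩ := hp
    have h1 : bM ^ 2 ∣ θ p - θ p₁ := Ideal.mem_span_singleton.mp (Ideal.Quotient.eq.mp hpI)
    -- Both divide `b ^ 2`, which divides their difference, so each divides the other.
    have hassoc : Associated (θ p) (θ p₁) := associated_of_dvd_dvd
      ((dvd_sub_right dvd_rfl).mp ((hdvd p hpS).trans h1))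
      ((dvd_sub_left dvd_rfl).mp ((hdvd p₁ hp₁).trans h1))
    obtain ⟨u, hu⟩ := hassoc
    refine ⟨u, fun _ ↦ ?_⟩
    have h2 := hθ p hpS
    have h3 := hθ p₁ hp₁
    rw [← hu, ← h2, RingOfIntegers.coe_eq_algebraMap, map_mul] at h3
    have hθ0 : (θ p : M) ≠ 0 := fun h ↦ by
      rw [h, zero_mul] at h2
      exact mul_ne_zero hbM0' (hlin p₀ hp₀) h2.symm
    exact (mul_left_cancel₀ hθ0 (by rw [← h3, mul_assoc])).symm
  choose u hu using hunit
  rw [numRootsOfUnity_eq_card_torsion]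
  refine Set.finite_and_ncard_le_mul T (fun p ↦ unitsMulComplexConjInv M (u p)) fun p hp ↦ ?_
  have hsub : {q ∈ T | unitsMulComplexConjInv M (u q) = unitsMulComplexConjInv M (u p)} ⊆
      {p, -p} := by
    rintro q ⟨hq, hqp⟩
    -- Equal values of `u / u'` make the quotient of the two units invariant under conjugation.
    have hreal : unitsComplexConj M (u q * (u p)⁻¹) = u q * (u p)⁻¹ := by
      have : unitsMulComplexConjInv M (u q * (u p)⁻¹) = 1 := by
        rw [map_mul, map_inv, hqp, mul_inv_cancel]
      have := congrArg Subtype.val this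
      rw [unitsMulComplexConjInv_apply] at this
      exact (mul_inv_eq_one.mp this).symm
    refine eq_or_eq_neg_of_linearFactor_eq_mul hconj hn hb hq.1 hp.1
      (r := (((u q * (u p)⁻¹ : (𝓞 M)ˣ) : 𝓞 M) : M)) ?_ ?_
    · exact congrArg (fun z : (𝓞 M)ˣ ↦ ((z : 𝓞 M) : M)) hreal
    · rw [hu p hp, hu q hq, ← mul_assoc, RingOfIntegers.coe_eq_algebraMap,
        RingOfIntegers.coe_eq_algebraMap, RingOfIntegers.coe_eq_algebraMap, ← map_mul,
        ← Units.val_mul, inv_mul_cancel_right]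
  exact ⟨Set.Finite.subset (Set.toFinite _) hsub,
    (Set.ncard_le_ncard hsub).trans ((Set.ncard_insert_le _ _).trans (by simp))⟩

end Counting

/-! ### The heights of `F` and `Γ` -/

section HeightOfForm

open IsCMField

variable {K : Type*} [Field K] [NumberField K] [IsTotallyReal K]
  {M : Type*} [Field M] [NumberField M] [IsCMField M] [Algebra K M]
  {c : ℕ → 𝓞 K} {n : ℕ} {α : M}

/-- The family `a` serves for both `H(F)` and `H(Γ)`. Its entry `±1` makes the local suprema at
least `1` and removes the finite places from its height. -/
lemma absHeight_le_mulHeight_of_binaryForm_eq (hn : n ≠ 0) (h0 : c n ≠ 0)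
    (hα : binaryForm (algebraMap (𝓞 K) M ∘ c) n α 1 = 0) (hconj : complexConj M α ≠ α)
    {ι : Type*} [Finite ι] {a : ι → 𝓞 K} (ha : ∃ j, IsPlusMinusOne (a j))
    (hc : ∀ i ≤ n, c i ≠ 0 → ∃ j, a j = c i) {b x y z : 𝓞 K} (hb : b ≠ 0)
    (hxy : binaryForm c n x y = b)
    (hz : ∀ v : InfinitePlace K, v (z : K) ≤ max (v (x : K)) (v (y : K))) :
    absHeight z ≤ 8 * absHeight b ^ (1 / (n : ℝ)) *
      (Height.mulHeight (fun j ↦ (a j : K)) ^ (1 / (Module.finrank ℚ K : ℝ))) ^ (1 + 1 / (n : ℝ)) *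
      (absNorm (c n ^ (n - 1) * b) : ℝ) ^ (1 / (Module.finrank ℚ K : ℝ)) := by
  have hle : ∀ (v : InfinitePlace K) j, v (a j : K) ≤ ⨆ j, v (a j : K) := fun v j ↦
    le_ciSup (f := fun j ↦ v (a j : K)) (Set.finite_range _).bddAbove j
  obtain ⟨j, hj⟩ := ha
  have hB1 : ∀ v : InfinitePlace K, 1 ≤ ⨆ j, v (a j : K) := fun v ↦ by
    refine le_of_eq_of_le ?_ (hle v j)
    rcases hj with hj | hj
    · rw [hj, RingOfIntegers.coe_eq_algebraMap, map_one, map_one]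
    · rw [hj, RingOfIntegers.coe_eq_algebraMap, map_neg, map_one, v.apply_neg, map_one]
  refine absHeight_le_of_binaryForm_eq hn h0 hα hconj hB1 (fun v i hi ↦ ?_) hb hxy hz
    (Real.rpow_pos_of_pos (Height.mulHeight_pos _) _) ?_
  · rcases eq_or_ne (c i) 0 with h | h
    · rw [h, RingOfIntegers.coe_eq_algebraMap, map_zero, map_zero]
      exact zero_le_one.trans (hB1 v)
    · obtain ⟨j, hj⟩ := hc i hi h
      exact hj ▸ hle v j
  · rw [one_div, Real.rpow_inv_natCast_pow (Height.mulHeight_pos _).le Module.finrank_pos.ne']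
    refine mulHeight_eq_prod_infinitePlace a ⟨j, ?_⟩
    rcases hj with hj | hj
    · rw [hj]; exact isUnit_one
    · rw [hj]; exact isUnit_one.neg

variable {F : MvPolynomial (Fin 2) (𝓞 K)}

lemma absHeight_le_polyHeight (hn : n ≠ 0) (hF : F.IsHomogeneous n)
    (ha₀ : IsPlusMinusOne (F.coeff (Finsupp.single 0 n)))
    (hα : MvPolynomial.aeval ![α, 1] F = 0) (hconj : complexConj M α ≠ α) {b x y z : 𝓞 K}
    (hb : b ≠ 0) (hxy : MvPolynomial.eval ![x, y] F = b)
    (hz : ∀ v : InfinitePlace K, v (z : K) ≤ max (v (x : K)) (v (y : K))) :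
    absHeight z ≤ 8 * absHeight b ^ (1 / (n : ℝ)) * polyHeight F ^ (1 + 1 / (n : ℝ)) *
      (absNorm b : ℝ) ^ (1 / (Module.finrank ℚ K : ℝ)) := by
  have hu : IsUnit (F.coeff (Finsupp.single 0 n)) := by
    rcases ha₀ with h | h
    · rw [h]; exact isUnit_one
    · rw [h]; exact isUnit_one.neg
  have key := absHeight_le_mulHeight_of_binaryForm_eq
    (c := fun i ↦ F.coeff (Finsupp.single 0 i + Finsupp.single 1 (n - i))) hn
    (by simpa using hu.ne_zero) ((hF.aeval_eq_binaryForm α 1).symm.trans hα) hconj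
    (a := fun m : F.support ↦ F.coeff m.1)
    ⟨⟨Finsupp.single 0 n, MvPolynomial.mem_support_iff.mpr hu.ne_zero⟩, ha₀⟩
    (fun i _ h ↦ ⟨⟨_, MvPolynomial.mem_support_iff.mpr h⟩, rfl⟩) hb
    ((hF.eval_eq_binaryForm x y).symm.trans hxy) hz
  rw [absNorm_mul, absNorm_pow] at key
  simpa [absNorm_eq_one_of_isUnit hu, polyHeight] using key

lemma absHeight_le_polyHeightOne (hn : n ≠ 0) (hF : F.IsHomogeneous n)
    (ha₀ : F.coeff (Finsupp.single 0 n) ≠ 0)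
    (hα : MvPolynomial.aeval ![α, 1] F = 0) (hconj : complexConj M α ≠ α) {b x y z : 𝓞 K}
    (hb : b ≠ 0) (hxy : MvPolynomial.eval ![x, y] F = b)
    (hz : ∀ v : InfinitePlace K, v (z : K) ≤ max (v (x : K)) (v (y : K))) :
    absHeight z ≤ 8 * absHeight b ^ (1 / (n : ℝ)) * polyHeightOne F ^ (1 + 1 / (n : ℝ)) *
      (absNorm (F.coeff (Finsupp.single 0 n) ^ (n - 1) * b) : ℝ) ^
        (1 / (Module.finrank ℚ K : ℝ)) := by
  have key := absHeight_le_mulHeight_of_binaryForm_eq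
    (c := fun i ↦ F.coeff (Finsupp.single 0 i + Finsupp.single 1 (n - i))) hn
    (by simpa using ha₀) ((hF.aeval_eq_binaryForm α 1).symm.trans hα) hconj
    (a := fun i : Option F.support ↦ i.elim 1 fun m ↦ F.coeff m.1)
    ⟨none, .inl rfl⟩
    (fun i _ h ↦ ⟨some ⟨_, MvPolynomial.mem_support_iff.mpr h⟩, rfl⟩) hb
    ((hF.eval_eq_binaryForm x y).symm.trans hxy) hz
  have e : polyHeightOne F = Height.mulHeight (fun i : Option F.support ↦
      ((i.elim 1 fun m ↦ F.coeff m.1 : 𝓞 K) : K)) ^ (1 / (Module.finrank ℚ K : ℝ)) := by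
    rw [polyHeightOne]
    congr 2
    funext i
    cases i with
    | none => simp
    | some m => rfl
  rw [e]
  simpa using key

end HeightOfForm

/-! ### The field generated by the root -/

section GeneratedCMField

open IsCMField

variable {K : Type*} [Field K] {L : Type*} [Field L] [Algebra K L] {α : L}

/-- Conjugation fixes `K`; fixing the generator too, it would be the identity. -/
lemma NumberField.IsCMField.complexConj_gen_ne [IsTotallyReal K] [NumberField K⟮α⟯]
    [IsCMField K⟮α⟯] : complexConj K⟮α⟯ (AdjoinSimple.gen K α) ≠ AdjoinSimple.gen K α := by
  intro h
  let f : K⟮α⟯ →ₐ[K] K⟮α⟯ :=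
    { (complexConj K⟮α⟯ : K⟮α⟯ →+* K⟮α⟯) with commutes' := complexConj_algebraMap }
  have hf : f = AlgHom.id K K⟮α⟯ := by
    refine IntermediateField.adjoin_algHom_ext K fun x hx ↦ ?_
    obtain rfl := Set.mem_singleton_iff.mp hx
    exact h
  exact complexConj_ne_one K⟮α⟯ (AlgEquiv.ext fun x ↦ DFunLike.congr_fun hf x)

lemma isIntegral_and_finrank_adjoin_le {c : ℕ → K} {n : ℕ} (hc : ∃ i ≤ n, c i ≠ 0)
    (hα : binaryForm (algebraMap K L ∘ c) n α 1 = 0) :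
    IsIntegral K α ∧ Module.finrank K K⟮α⟯ ≤ n := by
  obtain ⟨i, hi, hci⟩ := hc
  let p : Polynomial K := ∑ i ∈ Finset.range (n + 1), Polynomial.C (c i) * Polynomial.X ^ i
  have hp : Polynomial.aeval α p = 0 := by
    rw [← hα]; simp [p, binaryForm]
  have hcoeff : p.coeff i = c i := by
    simp [p, Polynomial.finsetSum_coeff, Nat.lt_succ_iff.mpr hi]
  have hp0 : p ≠ 0 := fun h ↦ hci (by rw [← hcoeff, h, Polynomial.coeff_zero])
  have hint : IsIntegral K α := IsAlgebraic.isIntegral ⟨p, hp0, hp⟩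
  refine ⟨hint, ?_⟩
  rw [IntermediateField.adjoin.finrank hint]
  refine (Polynomial.natDegree_le_of_dvd (minpoly.dvd K α hp) hp0).trans ?_
  refine Polynomial.natDegree_sum_le_of_forall_le _ _ fun i hi ↦ ?_
  exact (Polynomial.natDegree_C_mul_X_pow_le _ _).trans (Finset.mem_range_succ_iff.mp hi)

end GeneratedCMField

/-! ### Comparison of exponents and the final theorem -/

section Exponents

/-- Weakens the bound with constant `8` to the stated shapes; strictness comes from `c < c'`. -/
lemma mul_rpow_lt_of_le {z h h' q N s s' c c' : ℝ} (hN : 1 ≤ N) (hq : 0 < q)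
    (hh : 0 < h) (hle : h ≤ h') (hs : s ≤ s') (hc : 0 < c) (hcc : c < c')
    (hz : z ≤ c * q * h * N ^ s) : z < c' * q * h' * N ^ s' := by
  have hN' : N ^ s ≤ N ^ s' := Real.rpow_le_rpow_of_exponent_le hN hs
  have hNpos : 0 < N ^ s := Real.rpow_pos_of_pos (by linarith) s
  calc z ≤ c * q * h * N ^ s := hz
    _ < c' * q * h * N ^ s := by gcongr
    _ ≤ _ := by
      have hc' : 0 < c' := hc.trans hcc
      have hh' : 0 < h' := hh.trans_le hle
      gcongr

end Exponents

theorem theorem1 {K : Type*} [Field K] [NumberField K] [IsTotallyReal K]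
    (d : ℕ) (hd : d = Module.finrank ℚ K)
    (b : 𝓞 K) (hb : b ≠ 0) (n : ℕ) (hn : 2 ≤ n)
    (F : MvPolynomial (Fin 2) (𝓞 K)) (hF : F.IsHomogeneous n)
    (a₀ aₙ : 𝓞 K)
    (ha₀ : a₀ = F.coeff (Finsupp.single 0 n)) (haₙ : aₙ = F.coeff (Finsupp.single 1 n))
    {L : Type*} [Field L] [CharZero L] [Algebra K L] (α : L)
    (hα : MvPolynomial.aeval ![α, 1] (MvPolynomial.map (algebraMap (𝓞 K) K) F) = 0)
    (hCM : IsCMField K⟮α⟯) :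
    (∀ x y : 𝓞 K, (x, y) ∈ thueSolutions F b →
      (IsPlusMinusOne a₀ → IsPlusMinusOne aₙ →
        absHeight x < 32 * absHeight b ^ (1 / (n : ℝ)) * polyHeight F ^ (1 + 1 / (n : ℝ)) *
            (absNorm b : ℝ) ^ (2 / (d : ℝ)) ∧
        absHeight y < 32 * absHeight b ^ (1 / (n : ℝ)) * polyHeight F ^ (1 + 1 / (n : ℝ)) *
            (absNorm b : ℝ) ^ (2 / (d : ℝ))) ∧
      (IsPlusMinusOne a₀ → ¬ IsPlusMinusOne aₙ →
        absHeight x < 2 ^ 9 * absHeight b ^ (1 / (n : ℝ)) * polyHeight F ^ (2 + 1 / (n : ℝ)) *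
            (absNorm b : ℝ) ^ (4 / (d : ℝ)) ∧
        absHeight y < 32 * absHeight b ^ (1 / (n : ℝ)) * polyHeight F ^ (1 + 1 / (n : ℝ)) *
            (absNorm b : ℝ) ^ (2 / (d : ℝ))) ∧
      (a₀ ≠ 0 → ¬ IsPlusMinusOne a₀ → ¬ IsPlusMinusOne aₙ →
        absHeight x < 2 ^ 9 * absHeight b ^ (1 / (n : ℝ)) * polyHeightOne F ^ (2 * n + 1) *
            (absNorm b : ℝ) ^ (4 / (d : ℝ)) * absHeight a₀ ^ (n - 1) *
            (absNorm a₀ : ℝ) ^ (2 * ((n : ℝ) - 1) / (d : ℝ)) ∧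
        absHeight y < 32 * absHeight b ^ (1 / (n : ℝ)) * polyHeightOne F ^ (n + 1) *
            (absNorm b : ℝ) ^ (2 / (d : ℝ)) * absHeight a₀ ^ (n - 1) *
            (absNorm a₀ : ℝ) ^ (2 * ((n : ℝ) - 1) / (d : ℝ)))) ∧
    (thueSolutions F b).Finite ∧
    (thueSolutions F b).ncard ≤ 72 * 4 ^ (d * n) * absNorm b ^ (2 * n) ∧
    (IsUnit b → (thueSolutions F b).ncard ≤ 2 * numRootsOfUnity K⟮α⟯ * n) := by
  subst hd
  have hn0 : n ≠ 0 := by omega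
  -- A solution of `F(x, y) = b ≠ 0` shows `F ≠ 0`, which makes `α` algebraic over `K`.
  rcases (thueSolutions F b).eq_empty_or_nonempty with hS | ⟨p₀, hp₀⟩
  · simp [hS]
  let c : ℕ → 𝓞 K := fun i ↦ F.coeff (Finsupp.single 0 i + Finsupp.single 1 (n - i))
  have hsol : thueSolutions F b = {p | binaryForm c n p.1 p.2 = b} := by
    ext p
    rw [thueSolutions, Set.mem_ofPred, hF.eval_eq_binaryForm]
    rfl
  have hc : ∃ i ≤ n, (c i : K) ≠ 0 := by
    by_contra! h
    refine hb ?_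
    rw [hsol] at hp₀
    rw [← (show binaryForm c n p₀.1 p₀.2 = b from hp₀), binaryForm]
    refine Finset.sum_eq_zero fun i hi ↦ ?_
    rw [RingOfIntegers.coe_eq_zero_iff.mp (h i (Finset.mem_range_succ_iff.mp hi)), zero_mul,
      zero_mul]
  have hαL : binaryForm (algebraMap K L ∘ fun i ↦ (c i : K)) n α 1 = 0 := by
    rw [(hF.map (algebraMap (𝓞 K) K)).aeval_eq_binaryForm] at hα
    simp only [MvPolynomial.coeff_map] at hα
    exact hα
  obtain ⟨hint, hdeg⟩ := isIntegral_and_finrank_adjoin_le hc hαL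
  have : FiniteDimensional K K⟮α⟯ := IntermediateField.adjoin.finiteDimensional hint
  have : FiniteDimensional ℚ K⟮α⟯ := FiniteDimensional.trans ℚ K K⟮α⟯
  have : NumberField K⟮α⟯ := { }
  have hconj := IsCMField.complexConj_gen_ne (K := K) (α := α)
  have hαM : MvPolynomial.aeval ![AdjoinSimple.gen K α, 1] F = 0 := by
    rw [hF.aeval_eq_binaryForm]
    apply (algebraMap K⟮α⟯ L).injective
    rw [map_binaryForm, AdjoinSimple.algebraMap_gen, map_one, map_zero]
    exact hαL
  have hd0 : (0 : ℝ) < Module.finrank ℚ K := Nat.cast_pos.mpr Module.finrank_pos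
  refine ⟨fun x y hxy ↦ ?_, ?_⟩
  · have hb1 : 0 < absHeight b ^ (1 / (n : ℝ)) :=
      Real.rpow_pos_of_pos (zero_lt_one.trans_le (one_le_absHeight b)) _
    have hNb := one_le_absNorm hb
    have hh1 : 1 ≤ polyHeight F := Real.one_le_rpow (Height.one_le_mulHeight _) (by positivity)
    have hΓ1 : 1 ≤ polyHeightOne F :=
      Real.one_le_rpow (Height.one_le_mulHeight _) (by positivity)
    have hle : ∀ z ∈ ({x, y} : Set (𝓞 K)), ∀ v : InfinitePlace K,
        v (z : K) ≤ max (v (x : K)) (v (y : K)) := by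
      rintro z (rfl | rfl) v
      · exact le_max_left _ _
      · exact le_max_right _ _
    have hexp : ∀ k : ℝ, 1 ≤ k → 1 / (Module.finrank ℚ K : ℝ) ≤ k / Module.finrank ℚ K :=
      fun k hk ↦ by gcongr
    have key1 : IsPlusMinusOne a₀ → ∀ z ∈ ({x, y} : Set (𝓞 K)), ∀ k l e : ℝ, 8 < k → 1 ≤ l →
        1 ≤ e → absHeight z < k * absHeight b ^ (1 / (n : ℝ)) *
          polyHeight F ^ (e + 1 / (n : ℝ)) * (absNorm b : ℝ) ^ (l / (Module.finrank ℚ K : ℝ)) := by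
      intro h z hz k l e hk hl he
      refine mul_rpow_lt_of_le hNb hb1 (by positivity) ?_ (hexp l hl) (by norm_num) hk
        (absHeight_le_polyHeight hn0 hF (ha₀ ▸ h) hαM hconj hb hxy (hle z hz))
      exact Real.rpow_le_rpow_of_exponent_le hh1 (by gcongr)
    have key2 : a₀ ≠ 0 → ∀ z ∈ ({x, y} : Set (𝓞 K)), ∀ (k l : ℝ) (e : ℕ), 8 < k → 1 ≤ l →
        2 ≤ e → absHeight z < k * absHeight b ^ (1 / (n : ℝ)) *
          polyHeightOne F ^ e * (absNorm b : ℝ) ^ (l / (Module.finrank ℚ K : ℝ)) *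
          absHeight a₀ ^ (n - 1) *
          (absNorm a₀ : ℝ) ^ (2 * ((n : ℝ) - 1) / (Module.finrank ℚ K : ℝ)) := by
      intro h z hz k l e hk hl he
      have h1 := absHeight_le_polyHeightOne hn0 hF (ha₀ ▸ h) hαM hconj hb hxy (hle z hz)
      have hNa := one_le_absNorm h
      rw [← ha₀, absNorm_mul, absNorm_pow, Nat.cast_mul, Nat.cast_pow,
        Real.mul_rpow (by positivity) (by positivity), mul_comm ((_ : ℝ) ^ (1 / _)),
        ← mul_assoc] at h1
      -- The exponent `1 + 1 / n` is at most `2`, hence at most `n + 1` and `2 n + 1`.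
      have hP : polyHeightOne F ^ (1 + 1 / (n : ℝ)) ≤ polyHeightOne F ^ e := by
        rw [← Real.rpow_natCast]
        refine Real.rpow_le_rpow_of_exponent_le hΓ1 ?_
        have : 1 / (n : ℝ) ≤ 1 := by
          rw [div_le_one (by positivity)]
          exact_mod_cast hn0.bot_lt
        have : (2 : ℝ) ≤ e := by exact_mod_cast he
        linarith
      have hA : ((absNorm a₀ : ℝ) ^ (n - 1)) ^ (1 / (Module.finrank ℚ K : ℝ)) ≤
          absHeight a₀ ^ (n - 1) *
            (absNorm a₀ : ℝ) ^ (2 * ((n : ℝ) - 1) / (Module.finrank ℚ K : ℝ)) := by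
        rw [← Real.rpow_natCast_mul (by positivity), Nat.cast_pred hn0.bot_lt, mul_one_div]
        refine le_trans ?_ (le_mul_of_one_le_left (by positivity)
          (one_le_pow₀ (one_le_absHeight a₀)))
        refine Real.rpow_le_rpow_of_exponent_le hNa ?_
        have : (1 : ℝ) ≤ n := by exact_mod_cast hn0.bot_lt
        gcongr
        linarith
      have hlt := mul_rpow_lt_of_le hNb hb1 (by positivity) hP (hexp l hl) (by norm_num) hk le_rfl
      rw [mul_assoc _ (absHeight a₀ ^ (n - 1))]
      have hA0 : 0 < ((absNorm a₀ : ℝ) ^ (n - 1)) ^ (1 / (Module.finrank ℚ K : ℝ)) := by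
        positivity
      exact h1.trans_lt ((mul_lt_mul_of_pos_right hlt hA0).trans_le
        (mul_le_mul_of_nonneg_left hA (by positivity)))
    exact ⟨fun h _ ↦ ⟨key1 h x (by simp) _ _ _ (by norm_num) (by norm_num) le_rfl,
        key1 h y (by simp) _ _ _ (by norm_num) (by norm_num) le_rfl⟩,
      fun h _ ↦ ⟨key1 h x (by simp) _ _ _ (by norm_num) (by norm_num) (by norm_num),
        key1 h y (by simp) _ _ _ (by norm_num) (by norm_num) le_rfl⟩,
      fun h _ _ ↦ ⟨key2 h x (by simp) _ _ _ (by norm_num) (by norm_num) (by omega),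
        key2 h y (by simp) _ _ _ (by norm_num) (by norm_num) (by omega)⟩⟩
  · have hαB : binaryForm (algebraMap (𝓞 K) K⟮α⟯ ∘ c) n (AdjoinSimple.gen K α) 1 = 0 :=
      (hF.aeval_eq_binaryForm _ _).symm.trans hαM
    obtain ⟨hfin, hcard⟩ := finite_and_ncard_binaryForm_le hn0 hαB hconj hb
    rw [← hsol] at hfin hcard
    refine ⟨hfin, hcard.trans ?_, fun hu ↦ hcard.trans ?_⟩
    · have hN : 1 ≤ absNorm b := Nat.one_le_iff_ne_zero.mpr (absNorm_ne_zero hb)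
      -- Here `72 = 2 * 36`, and `w ≤ 3 ^ [M : ℚ] ≤ 4 ^ (d n)` is more than enough.
      have hw : numRootsOfUnity K⟮α⟯ ≤ 36 * 4 ^ (Module.finrank ℚ K * n) := by
        rw [numRootsOfUnity_eq_card_torsion]
        refine (card_torsion_le K⟮α⟯).trans ?_
        rw [← Module.finrank_mul_finrank ℚ K K⟮α⟯]
        calc 3 ^ (Module.finrank ℚ K * Module.finrank K K⟮α⟯)
            ≤ 4 ^ (Module.finrank ℚ K * Module.finrank K K⟮α⟯) :=
              Nat.pow_le_pow_left (by norm_num) _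
          _ ≤ 4 ^ (Module.finrank ℚ K * n) :=
              Nat.pow_le_pow_right (by norm_num) (Nat.mul_le_mul_left _ hdeg)
          _ ≤ _ := Nat.le_mul_of_pos_left _ (by norm_num)
      calc _ ≤ 2 * (36 * 4 ^ (Module.finrank ℚ K * n)) * absNorm b ^ (2 * n) := by
            gcongr
        _ = _ := by ring
    · rw [absNorm_eq_one_of_isUnit hu, one_pow, mul_one]
      exact Nat.le_mul_of_pos_right _ (by omega)
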